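/- Let $R$ be an associative ring with unit. An $\mathcal R$-module (respectively, a right $\mathcal R$-module) is a covariant additive functor from the category of left (respectively, right) $R$-modules to the category of abelian groups; morphisms are natural transformations, and $\operatorname{Hom}_{\mathcal R}$ and $\operatorname{Ext}_{\mathcal R}^i$ are taken in the abelian category of $\mathcal R$-modules. For a right $R$-module $M$ let $\mathcal M$ be the $\mathcal R$-module $\mathcal M(S)=M\otimes_R S$, and for a left $R$-module $S$ let $\mathcal S$ be the right $\mathcal R$-module $\mathcal S(N)=N\otimes_R S$. The dual of an $\mathcal R$-module $\mathbb M$ is the right $\mathcal R$-module $\mathbb M^*(N)=\operatorname{Hom}_{\mathcal R}(\mathbb M,\mathcal N)$; the dual of a right $\mathcal R$-module $\mathbb N$ is the $\mathcal R$-module $\mathbb N^*(S)=\operatorname{Hom}_{\mathcal R}(\mathbb N,\mathcal S)$. (If these Homs are not small, duals are regarded as functors to abelian groups of the next universe.) An $\mathcal R$-module $\mathbb M$ is reflexive if the natural morphism $\mathbb M\to\mathbb M^{**}$, $m\mapsto\tilde m$ for $m\in\mathbb M(S)$, where $\tilde m_N(w)=w_S(m)$ for $w\in\mathbb M^*(N)$,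 is an isomorphism. An FP module is an $\mathcal R$-module that preserves direct limits (over all upward directed sets) and direct products (over all sets). Theorem. Let $\mathbb F$ be an FP module. Then $\mathbb F$ is reflexive, and $$\operatorname{Ext}_{\mathcal R}^i(\mathbb F,\mathcal M)=0\quad\text{for every } i>0 \text{ and every right } R\text{-module } M.$$ -/

import Mathlib

open CategoryTheory CategoryTheory.Limits Opposite
open scoped TensorProduct

universe v u

/-! ### The abelian category of additive functors -/

namespace AddFun

variable {C D : Type*} [Category* C] [Category* D] [Preadditive C] [Abelian D]

instance : (additiveFunctor C D).IsClosedUnderSubobjects where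
  prop_of_mono {X Y} f _ hY := by
    have : Y.Additive := hY
    refine ⟨fun {A B a b} => ?_⟩
    rw [← cancel_mono (f.app B)]
    simp [Preadditive.add_comp]

instance : (additiveFunctor C D).IsClosedUnderQuotients where
  prop_of_epi {X Y} f _ hX := by
    have : X.Additive := hX
    refine ⟨fun {A B a b} => ?_⟩
    rw [← cancel_epi (f.app A)]
    simp [Preadditive.comp_add, ← NatTrans.naturality, Preadditive.add_comp]

instance : (additiveFunctor C D).ContainsZero where
  exists_zero := ⟨_, isZero_zero (C ⥤ D), Functor.Additive.of_isZero (isZero_zero (C ⥤ D))⟩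

instance : (additiveFunctor C D).IsClosedUnderFiniteProducts where
  isClosedUnderLimitsOfShape J _ := ⟨by
    rintro X ⟨p⟩
    have hp : ∀ j, (p.diag.obj j).Additive := p.prop_diag_obj
    refine ⟨fun {A B a b} => ?_⟩
    refine (isLimitOfPreserves ((evaluation C D).obj B) p.isLimit).hom_ext fun j => ?_
    simp [Preadditive.add_comp]⟩

end AddFun

/-! ### Functors of modules -/

/-- `RFun R` is the category of `𝓡`-modules: covariant additive functors from the category of (left)
`R`-modules to the category of abelian groups. A right `R`-module is a module over `Rᵐᵒᵖ`, so
that `RFun Rᵐᵒᵖ` is the category of right `𝓡`-modules. Usually the groups live in the same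
universe as the modules (`v = u`); as the morphisms between two such functors form a type in the
next universe, dual functors have `v = u + 1`. -/
abbrev RFun (R : Type u) [Ring R] := ModuleCat.{u} R ⥤+ AddCommGrpCat.{v}

instance (R : Type u) [Ring R] : HasExt.{u + 1} (RFun.{u} R) :=
  HasExt.standard _

namespace RFun

variable {R : Type u} [Ring R]

/-- An `𝓡`-module with `u`-small values, regarded as one with values in the next universe. -/
def lift : RFun.{u} R ⥤ RFun.{u + 1} R where
  obj F := AdditiveFunctor.of (F.obj ⋙ AddCommGrpCat.uliftFunctor.{u + 1, u})
  map α := ObjectProperty.homMk (Functor.whiskerRight α.hom _)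

instance : (lift (R := R)).Additive where
  map_add := by
    intros
    ext
    rfl

/-! ### The tensor product over a non-commutative ring -/

section Tensor

/-- The relations `m r ⊗ s = m ⊗ r s`. -/
def balancedRel (M : ModuleCat.{u} Rᵐᵒᵖ) (S : ModuleCat.{u} R) : AddSubgroup (M ⊗[ℤ] S) :=
  AddSubgroup.closure
    {x | ∃ (m : M) (r : R) (s : S), x = (MulOpposite.op r • m) ⊗ₜ[ℤ] s - m ⊗ₜ[ℤ] (r • s)}

/-- The abelian group `M ⊗_R S`, for a right `R`-module `M` and a left `R`-module `S`. -/
abbrev Tens (M : ModuleCat.{u} Rᵐᵒᵖ) (S : ModuleCat.{u} R) : Type u :=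
  (M ⊗[ℤ] S) ⧸ balancedRel M S

/-- The element `m ⊗ s` of `M ⊗_R S`. -/
def tmk {M : ModuleCat.{u} Rᵐᵒᵖ} {S : ModuleCat.{u} R} (m : M) (s : S) : Tens M S :=
  QuotientAddGroup.mk (m ⊗ₜ[ℤ] s)

theorem Tens.hom_ext {M : ModuleCat.{u} Rᵐᵒᵖ} {S : ModuleCat.{u} R} {A : Type*} [AddCommGroup A]
    {f g : Tens M S →+ A} (h : ∀ m s, f (tmk m s) = g (tmk m s)) : f = g := by
  refine QuotientAddGroup.addMonoidHom_ext _ (DFunLike.ext _ _ fun x => ?_)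
  induction x using TensorProduct.induction_on with
  | zero => simp
  | tmul m s => exact h m s
  | add x y hx hy => rw [map_add, map_add, hx, hy]

/-- The additive map `f ⊗ g : M ⊗_R S → M' ⊗_R S'`. -/
def tmap {M M' : ModuleCat.{u} Rᵐᵒᵖ} {S S' : ModuleCat.{u} R} (f : M ⟶ M') (g : S ⟶ S') :
    Tens M S →+ Tens M' S' :=
  QuotientAddGroup.map _ _
    (TensorProduct.map f.hom.toAddMonoidHom.toIntLinearMap
      g.hom.toAddMonoidHom.toIntLinearMap).toAddMonoidHom (by
    rw [balancedRel, AddSubgroup.closure_le]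
    rintro _ ⟨m, r, s, rfl⟩
    refine AddSubgroup.subset_closure ⟨f m, r, g s, ?_⟩
    simp)

@[simp]
theorem tmap_tmk {M M' : ModuleCat.{u} Rᵐᵒᵖ} {S S' : ModuleCat.{u} R} (f : M ⟶ M')
    (g : S ⟶ S') (m : M) (s : S) : tmap f g (tmk m s) = tmk (f m) (g s) := rfl

theorem add_tmk {M : ModuleCat.{u} Rᵐᵒᵖ} {S : ModuleCat.{u} R} (m m' : M) (s : S) :
    tmk (m + m') s = tmk m s + tmk m' s := by
  simp only [tmk, TensorProduct.add_tmul]; rfl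

theorem tmk_add {M : ModuleCat.{u} Rᵐᵒᵖ} {S : ModuleCat.{u} R} (m : M) (s s' : S) :
    tmk m (s + s') = tmk m s + tmk m s' := by
  simp only [tmk, TensorProduct.tmul_add]; rfl

end Tensor

/-! ### Quasi-coherent modules -/

/-- `M ↦ (S ↦ M ⊗_R S)`: the quasi-coherent `𝓡`-module associated with a right `R`-module. -/
def quasiCoherent (R : Type u) [Ring R] : ModuleCat.{u} Rᵐᵒᵖ ⥤ RFun.{u} R where
  obj M :=
    { obj :=
        { obj S := AddCommGrpCat.of (Tens M S)
          map g := AddCommGrpCat.ofHom (tmap (𝟙 M) g)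
          map_id _ := AddCommGrpCat.hom_ext (Tens.hom_ext fun _ _ => rfl)
          map_comp _ _ := AddCommGrpCat.hom_ext (Tens.hom_ext fun _ _ => rfl) }
      property :=
        { map_add := AddCommGrpCat.hom_ext (Tens.hom_ext fun _ _ => tmk_add _ _ _) } }
  map f := ObjectProperty.homMk
    { app S := AddCommGrpCat.ofHom (tmap f (𝟙 S))
      naturality _ _ _ := AddCommGrpCat.hom_ext (Tens.hom_ext fun _ _ => rfl) }
  map_id _ := by
    ext S : 3
    exact AddCommGrpCat.hom_ext (Tens.hom_ext fun _ _ => rfl)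
  map_comp _ _ := by
    ext S : 3
    exact AddCommGrpCat.hom_ext (Tens.hom_ext fun _ _ => rfl)

instance : (quasiCoherent R).Additive where
  map_add := by
    intros
    ext S : 3
    exact AddCommGrpCat.hom_ext (Tens.hom_ext fun _ _ => add_tmk _ _ _)

/-- `S ↦ (N ↦ N ⊗_R S)`: the quasi-coherent right `𝓡`-module associated with a left `R`-module. -/
def quasiCoherentRight (R : Type u) [Ring R] : ModuleCat.{u} R ⥤ RFun.{u} Rᵐᵒᵖ where
  obj S :=
    { obj :=
        { obj N := AddCommGrpCat.of (Tens N S)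
          map f := AddCommGrpCat.ofHom (tmap f (𝟙 S))
          map_id _ := AddCommGrpCat.hom_ext (Tens.hom_ext fun _ _ => rfl)
          map_comp _ _ := AddCommGrpCat.hom_ext (Tens.hom_ext fun _ _ => rfl) }
      property :=
        { map_add := AddCommGrpCat.hom_ext (Tens.hom_ext fun _ _ => add_tmk _ _ _) } }
  map g := ObjectProperty.homMk
    { app N := AddCommGrpCat.ofHom (tmap (𝟙 N) g)
      naturality _ _ _ := AddCommGrpCat.hom_ext (Tens.hom_ext fun _ _ => rfl) }
  map_id _ := by
    ext S : 3
    exact AddCommGrpCat.hom_ext (Tens.hom_ext fun _ _ => rfl)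
  map_comp _ _ := by
    ext S : 3
    exact AddCommGrpCat.hom_ext (Tens.hom_ext fun _ _ => rfl)

instance : (quasiCoherentRight R).Additive where
  map_add := by
    intros
    ext S : 3
    exact AddCommGrpCat.hom_ext (Tens.hom_ext fun _ _ => tmk_add _ _ _)

/-! ### Duals and reflexive functors -/

/-- For `𝕄` in a preadditive category, the additive functor `Hom(𝕄, -)`. -/
def homFrom {𝒜 : Type*} [Category.{v} 𝒜] [Preadditive 𝒜] (M : 𝒜) : 𝒜 ⥤ AddCommGrpCat.{v} where
  obj N := AddCommGrpCat.of (M ⟶ N)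
  map f := AddCommGrpCat.ofHom (Preadditive.rightComp M f)
  map_id _ := by
    ext
    exact Category.comp_id _
  map_comp _ _ := by
    ext
    exact (Category.assoc _ _ _).symm

instance {𝒜 : Type*} [Category.{v} 𝒜] [Preadditive 𝒜] (M : 𝒜) : (homFrom M).Additive where
  map_add := by
    intros
    ext
    exact Preadditive.comp_add _ _ _ _ _ _

/-- The dual right `𝓡`-module `𝕄^*` of an `𝓡`-module: `𝕄^*(N) = Hom_𝓡(𝕄, 𝓝)`. -/
def dual (M : RFun.{u + 1} R) : RFun.{u + 1} Rᵐᵒᵖ :=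
  AdditiveFunctor.of (quasiCoherent R ⋙ lift ⋙ homFrom M)

/-- The dual left `𝓡`-module of a right `𝓡`-module. -/
def dualRight (N : RFun.{u + 1} Rᵐᵒᵖ) : RFun.{u + 1} R :=
  AdditiveFunctor.of (quasiCoherentRight R ⋙ lift ⋙ homFrom N)

/-- For `m ∈ 𝕄(S)`, the morphism `m̃ : 𝕄^* → 𝓢`, `m̃_N(w) = w_S(m)` for `w : 𝕄 → 𝓝`. -/
def evalAt (M : RFun.{u + 1} R) (S : ModuleCat.{u} R) (m : M.obj.obj S) :
    M.dual ⟶ lift.obj ((quasiCoherentRight R).obj S) :=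
  ObjectProperty.homMk
    { app N := AddCommGrpCat.ofHom
        (AddMonoidHom.mk' (fun w : M ⟶ lift.obj ((quasiCoherent R).obj N) =>
          (w.hom.app S).hom m) fun _ _ => rfl)
      naturality _ _ _ := rfl }

theorem dual_hom_ext {M : RFun.{u + 1} R} {P : RFun.{u + 1} Rᵐᵒᵖ} {f g : M.dual ⟶ P}
    (h : ∀ (N : ModuleCat.{u} Rᵐᵒᵖ) (w : M ⟶ lift.obj ((quasiCoherent R).obj N)),
      (f.hom.app N).hom w = (g.hom.app N).hom w) : f = g := by
  ext N w
  exact h N w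

/-- The natural morphism `𝕄 → 𝕄^{**}`, `m ↦ m̃`. -/
def toBidual (M : RFun.{u + 1} R) : M ⟶ M.dual.dualRight :=
  ObjectProperty.homMk
    { app S := AddCommGrpCat.ofHom (AddMonoidHom.mk' (evalAt M S) fun m m' =>
        dual_hom_ext fun _ w => map_add (w.hom.app S).hom m m')
      naturality _ _ f := AddCommGrpCat.hom_ext <| AddMonoidHom.ext fun m =>
        dual_hom_ext fun _ w => congr($(w.hom.naturality f).hom m) }

/-- `𝕄` is reflexive if the natural morphism `𝕄 → 𝕄^{**}` is an isomorphism. -/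
def IsReflexive (M : RFun.{u + 1} R) : Prop :=
  IsIso M.toBidual

/-! ### FP modules -/

/-- `𝕄` preserves direct limits over all upward directed sets. -/
def PreservesDirectLimits (M : RFun.{v} R) : Prop :=
  ∀ (I : Type u) [Preorder I] [IsDirectedOrder I] [Nonempty I], PreservesColimitsOfShape I M.obj

/-- `𝕄` preserves direct products over all sets. -/
def PreservesDirectProducts (M : RFun.{v} R) : Prop :=
  ∀ I : Type u, PreservesLimitsOfShape (Discrete I) M.obj

/-- An FP module is an `𝓡`-module that preserves direct limits and direct products. -/
structure IsFP (F : RFun.{u} R) : Prop where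
  preservesDirectLimits : F.PreservesDirectLimits
  preservesDirectProducts : F.PreservesDirectProducts

end RFun

/-! An FP module has a presentation by representable functors, `F = coker(Hom(B', -) → Hom(B, -))`,
induced by some `g : B → B'` with `B` and `B'` finitely presented (`IsFP.exists_presentation`).
Preservation of products puts all elements of all `F(A)`, for `A` in a set of representatives of the
finitely presented modules, into one element of `F` of a product; preservation of direct limits
brings this element back to some `b ∈ F(B)` with `B` finitely presented. This `b` generates `F`, and
the same argument applied to its relations gives `g`.

Vanishing of `Ext`. The sequence `0 → Hom(coker g, -) → Hom(B', -) → Hom(B, -) → F → 0` is a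
projective resolution by Yoneda. Maps from it to `T` form the complex `T(B) → T(B') → T(coker g) →
0`, which is exact at its last two terms when `T` is right exact, as is every quasi-coherent module.
In the code this becomes dimension shifting along the kernel of `Hom(B, -) → F`, and an extension
lemma (`exists_extension`).

Reflexivity. By Yoneda, `F^*` is the kernel of `𝓑 → 𝓑'`, where `𝓑(N) = N ⊗ B`. As `B` is finitely
presented, `𝓑` is itself the cokernel of a map of representable functors
(`isPresented_quasiCoherentRight`), and likewise for `𝓑'`. Hence `exists_extension` applies again:
each `F^* → 𝓢` extends to `𝓑 → 𝓢`, that is, to a linear map `p : B → S`, and it is evaluation at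
`F(p)(b)`. If this evaluation is zero, then `𝓑 → 𝓢` kills the kernel of `𝓑 → 𝓑'`, so it extends to
`𝓑'`; thus `p` factors through `g` and `F(p)(b) = 0`. -/

namespace RFun

variable {R : Type u} [Ring R]

/-! ### Functors of modules, elementwise -/

section Elements

variable {F G : RFun.{v} R} {A B C : ModuleCat.{u} R}

/-- The additive map `F(A) → F(B)` induced by `f : A → B`. -/
def act (F : RFun.{v} R) (f : A ⟶ B) : F.obj.obj A →+ F.obj.obj B := (F.obj.map f).hom

/-- The component of a morphism of functors, as an additive map. -/
def component (w : F ⟶ G) (A : ModuleCat.{u} R) : F.obj.obj A →+ G.obj.obj A := (w.hom.app A).hom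

theorem act_id (x : F.obj.obj A) : F.act (𝟙 A) x = x :=
  congr($(F.obj.map_id A).hom x)

theorem act_comp (f : A ⟶ B) (g : B ⟶ C) (x : F.obj.obj A) :
    F.act (f ≫ g) x = F.act g (F.act f x) :=
  congr($(F.obj.map_comp f g).hom x)

theorem add_act (f g : A ⟶ B) (x : F.obj.obj A) : F.act (f + g) x = F.act f x + F.act g x := by
  have : F.obj.Additive := F.property
  exact congr($(F.obj.map_add (f := f) (g := g)).hom x)

theorem sub_act (f g : A ⟶ B) (x : F.obj.obj A) : F.act (f - g) x = F.act f x - F.act g x := by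
  rw [eq_sub_iff_add_eq, ← add_act, sub_add_cancel]

theorem zero_act (x : F.obj.obj A) : F.act (0 : A ⟶ B) x = 0 := by
  have := sub_act (0 : A ⟶ B) 0 x
  rwa [sub_self, sub_self] at this

theorem component_act (w : F ⟶ G) (f : A ⟶ B) (x : F.obj.obj A) :
    component w B (F.act f x) = G.act f (component w A x) :=
  congr($(w.hom.naturality f).hom x)

theorem hom_ext_component {w w' : F ⟶ G} (h : ∀ A x, component w A x = component w' A x) :
    w = w' := by
  ext A x
  exact h A x

/-- A morphism of functors from its components. -/
def mkHom (φ : ∀ A, F.obj.obj A →+ G.obj.obj A)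
    (h : ∀ {A B : ModuleCat.{u} R} (f : A ⟶ B) (x : F.obj.obj A),
      φ B (F.act f x) = G.act f (φ A x)) : F ⟶ G :=
  ObjectProperty.homMk
    { app A := AddCommGrpCat.ofHom (φ A)
      naturality _ _ f := AddCommGrpCat.hom_ext <| AddMonoidHom.ext (h f) }

theorem mono_of_injective (w : F ⟶ G) (h : ∀ A, Function.Injective (component w A)) : Mono w where
  right_cancellation _ _ e := hom_ext_component fun A x => h A congr(component $e A x)

theorem epi_of_surjective (w : F ⟶ G) (h : ∀ A, Function.Surjective (component w A)) : Epi w where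
  left_cancellation _ _ e := hom_ext_component fun A y => by
    obtain ⟨x, rfl⟩ := h A y
    exact congr(component $e A x)

/-- The pointwise cokernel of a morphism of functors. -/
def quot (w : F ⟶ G) : RFun.{v} R where
  obj :=
    { obj A := AddCommGrpCat.of (G.obj.obj A ⧸ (component w A).range)
      map {A B} f := AddCommGrpCat.ofHom (QuotientAddGroup.map _ _ (G.act f) (by
        rintro _ ⟨x, rfl⟩
        exact ⟨F.act f x, component_act w f x⟩))
      map_id A := AddCommGrpCat.hom_ext <| QuotientAddGroup.addMonoidHom_ext _ <|
        AddMonoidHom.ext fun x => congrArg QuotientAddGroup.mk (act_id x)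
      map_comp f g := AddCommGrpCat.hom_ext <| QuotientAddGroup.addMonoidHom_ext _ <|
        AddMonoidHom.ext fun x => congrArg QuotientAddGroup.mk (act_comp f g x) }
  property :=
    { map_add := AddCommGrpCat.hom_ext <| QuotientAddGroup.addMonoidHom_ext _ <|
        AddMonoidHom.ext fun x => congrArg QuotientAddGroup.mk (add_act _ _ x) }

/-- The projection to the pointwise cokernel vanishes after composition with `w`, hence vanishes. -/
theorem surjective_of_epi (w : F ⟶ G) [Epi w] (A : ModuleCat.{u} R) :
    Function.Surjective (component w A) := by
  let p : G ⟶ quot w := mkHom (fun A => QuotientAddGroup.mk' _) fun f x => rfl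
  have hp : p = 0 := by
    rw [← cancel_epi w]
    exact hom_ext_component fun A x => (QuotientAddGroup.eq_zero_iff _).2 ⟨x, rfl⟩
  intro y
  exact (QuotientAddGroup.eq_zero_iff y).1 congr(component $hp A y)

/-- The pointwise kernel of a morphism of functors. -/
def ker (w : F ⟶ G) : RFun.{v} R where
  obj :=
    { obj A := AddCommGrpCat.of (component w A).ker
      map {A B} f := AddCommGrpCat.ofHom (((F.act f).comp (AddSubgroup.subtype _)).codRestrict _
        fun x => by
          rw [AddMonoidHom.mem_ker]
          refine (component_act w f x.1).trans ?_
          rw [AddMonoidHom.mem_ker.1 x.2, map_zero])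
      map_id A := AddCommGrpCat.hom_ext <| AddMonoidHom.ext fun x => Subtype.ext (act_id x.1)
      map_comp f g := AddCommGrpCat.hom_ext <| AddMonoidHom.ext fun x =>
        Subtype.ext (act_comp f g x.1) }
  property :=
    { map_add := AddCommGrpCat.hom_ext <| AddMonoidHom.ext fun x =>
        Subtype.ext (add_act _ _ x.1) }

/-- The inclusion of the pointwise kernel. -/
def kerι (w : F ⟶ G) : ker w ⟶ F := mkHom (fun _ => AddSubgroup.subtype _) fun _ _ => rfl

theorem kerι_comp (w : F ⟶ G) : kerι w ≫ w = 0 := hom_ext_component fun _ x => x.2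

theorem kerι_shortExact (w : F ⟶ G) (hw : ∀ A, Function.Surjective (component w A)) :
    (ShortComplex.mk (kerι w) w (kerι_comp w)).ShortExact := by
  have : Mono (kerι w) := mono_of_injective _ fun A => Subtype.val_injective
  have : Epi w := epi_of_surjective w hw
  refine .mk (ShortComplex.exact_of_f_is_kernel _ (KernelFork.IsLimit.ofι' _ _ fun k hk => ?_))
  refine ⟨mkHom (fun A => (component k A).codRestrict _ fun x => congr(component $hk A x))
    fun f x => Subtype.ext (component_act k f x), rfl⟩

end Elements

/-! ### Functors with a presentation by representable functors -/

section Presented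

variable {D F G T X Y : RFun.{v} R} {B B' : ModuleCat.{u} R}

/-- `F` is generated by `b ∈ F(B)`. -/
def IsGenerator (b : F.obj.obj B) : Prop := ∀ S (x : F.obj.obj S), ∃ f : B ⟶ S, F.act f b = x

/-- The kernel of `Hom(B, -) → F` given by `b ∈ F(B)` is generated by `g : B → B'`. -/
def IsRelator (b : F.obj.obj B) (g : B ⟶ B') : Prop :=
  ∀ S (f : B ⟶ S), F.act f b = 0 ↔ ∃ h : B' ⟶ S, f = g ≫ h

/-- `F` is the cokernel of a morphism between representable functors. -/
def IsPresented (F : RFun.{v} R) : Prop :=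
  ∃ (B B' : ModuleCat.{u} R) (g : B ⟶ B') (b : F.obj.obj B), IsGenerator b ∧ IsRelator b g

/-- `T` is right exact. -/
def IsRightExact (T : RFun.{v} R) : Prop :=
  ∀ ⦃A B C : ModuleCat.{u} R⦄ (f : A ⟶ B) (g : B ⟶ C), Function.Surjective g →
    Function.Exact f g → ∀ t, T.act g t = 0 → ∃ t', T.act f t' = t

/-- A morphism from a functor generated by `b` is given by an element satisfying the relations
of `b`. -/
theorem exists_hom_of_isGenerator {b : F.obj.obj B} (hb : IsGenerator b) (t : T.obj.obj B)
    (ht : ∀ S (f : B ⟶ S), F.act f b = 0 → T.act f t = 0) :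
    ∃ w : F ⟶ T, component w B b = t := by
  choose f hf using hb
  -- The value does not depend on the chosen multiple of `b`: two choices differ by a relation,
  -- which `t` satisfies.
  have key : ∀ S (x : F.obj.obj S) (k : B ⟶ S), F.act k b = x → T.act (f S x) t = T.act k t := by
    intro S x k hk
    rw [← sub_eq_zero, ← sub_act]
    apply ht
    rw [sub_act, hf, hk, sub_self]
  refine ⟨mkHom (fun S => AddMonoidHom.mk' (fun x => T.act (f S x) t) fun x y => ?_)
    fun {S S'} k x => ?_, ?_⟩
  · rw [← add_act]
    exact key _ _ _ (by rw [add_act, hf, hf])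
  · change T.act (f S' _) t = T.act k (T.act _ t)
    rw [← act_comp]
    exact key _ _ _ (by rw [act_comp, hf])
  · exact (key _ _ (𝟙 B) (act_id b)).trans (act_id t)

/-- If `x = F(k)(b)`, then `f` kills `x` exactly when `k ≫ f` factors through `g`, so the relations
of `x` are given by the pushout of `g` along `k`. -/
theorem exists_isRelator {b : F.obj.obj B} {g : B ⟶ B'} (hb : IsGenerator b) (hg : IsRelator b g)
    {A : ModuleCat.{u} R} (x : F.obj.obj A) :
    ∃ (Q : ModuleCat.{u} R) (q : A ⟶ Q), IsRelator x q := by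
  obtain ⟨k, rfl⟩ := hb A x
  refine ⟨pushout k g, pushout.inl k g, fun S f => ?_⟩
  rw [← act_comp, hg]
  constructor
  · rintro ⟨h, e⟩
    exact ⟨pushout.desc f h e, (pushout.inl_desc _ _ _).symm⟩
  · rintro ⟨h, rfl⟩
    exact ⟨pushout.inr k g ≫ h, by rw [← Category.assoc, pushout.condition, Category.assoc]⟩

/-- A morphism to a right exact functor extends along `i : D → X` if the cokernel of `i` has a
presentation. -/
theorem exists_extension (hT : T.IsRightExact) (i : D ⟶ X) (η : D ⟶ T)
    (hη : ∀ S d, component i S d = 0 → component η S d = 0)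
    {X₀ Q : ModuleCat.{u} R} {x₀ : X.obj.obj X₀} (hx₀ : IsGenerator x₀) (q : X₀ ⟶ Q)
    (hq : ∀ S (f : X₀ ⟶ S), (∃ d, component i S d = X.act f x₀) ↔ ∃ h : Q ⟶ S, f = q ≫ h) :
    ∃ ε : X ⟶ T, i ≫ ε = η := by
  -- `d₀ ∈ D(Q)` is the universal element of `D` whose image is a multiple of `x₀`. Its image under
  -- `η` dies in `T(coker q)`, so right exactness lifts it to `t ∈ T(X₀)`, the future value of the
  -- extension at `x₀`.
  obtain ⟨d₀, hd₀⟩ := (hq Q q).2 ⟨𝟙 Q, (Category.comp_id q).symm⟩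
  let π : Q ⟶ ModuleCat.of R (Q ⧸ LinearMap.range q.hom) := ModuleCat.ofHom (Submodule.mkQ _)
  have hπ : q ≫ π = 0 := by
    ext x
    exact (Submodule.Quotient.mk_eq_zero _).2 ⟨x, rfl⟩
  obtain ⟨t, ht⟩ := hT q π (Submodule.mkQ_surjective _)
    (LinearMap.exact_iff.2 (Submodule.ker_mkQ _)) (component η Q d₀) (by
      rw [← component_act]
      apply hη
      rw [component_act, hd₀, ← act_comp, hπ, zero_act])
  have key : ∀ S (f : X₀ ⟶ S) d, component i S d = X.act f x₀ →
      component η S d = T.act f t := by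
    intro S f d hd
    obtain ⟨h, rfl⟩ := (hq S f).1 ⟨d, hd⟩
    rw [act_comp, ht, ← component_act, ← sub_eq_zero, ← map_sub]
    apply hη
    rw [map_sub, component_act, hd, hd₀, act_comp, sub_self]
  -- The relations of `x₀` hold for `t`: if `f` kills `x₀`, then `key` with `d = 0` applies.
  obtain ⟨ε, hε⟩ := exists_hom_of_isGenerator hx₀ t fun S f hf => by
    rw [← key S f 0 (by rw [hf, map_zero]), map_zero]
  refine ⟨ε, hom_ext_component fun S d => ?_⟩
  obtain ⟨f, hf⟩ := hx₀ S (component i S d)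
  rw [key S f d hf.symm, ← hε, ← component_act, hf]
  rfl

end Presented

/-! ### Vanishing of `Ext` -/

section Ext

variable {F T : RFun.{u} R} {B B' : ModuleCat.{u} R}

/-- The functor `Hom(B, -)`. -/
def repr (B : ModuleCat.{u} R) : RFun.{u} R := AdditiveFunctor.of (homFrom B)

theorem isGenerator_id (B : ModuleCat.{u} R) : IsGenerator (F := repr B) (𝟙 B) :=
  fun _ f => ⟨f, Category.id_comp f⟩

theorem exists_hom_repr (t : T.obj.obj B) :
    ∃ w : repr B ⟶ T, component w B (𝟙 B) = t :=
  exists_hom_of_isGenerator (isGenerator_id B) t fun S f hf => by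
    have hf : f = 0 := (Category.id_comp f).symm.trans hf
    rw [hf, zero_act]

theorem component_repr (w : repr B ⟶ T) {S : ModuleCat.{u} R} (f : B ⟶ S) :
    component w S f = T.act f (component w B (𝟙 B)) :=
  (congrArg (component w S) (Category.id_comp f).symm).trans (component_act w f (𝟙 B))

instance (B : ModuleCat.{u} R) : Projective (repr B) where
  factors {E X} f e _ := by
    obtain ⟨y, hy⟩ := surjective_of_epi e B (component f B (𝟙 B))
    obtain ⟨w, hw⟩ := exists_hom_repr y
    refine ⟨w, hom_ext_component fun S x => ?_⟩
    refine (component_repr (w ≫ e) x).trans (.trans ?_ (component_repr f x).symm)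
    rw [← hy, ← hw]
    rfl

/-- The kernel consists of the multiples `g ≫ h` of `g`, and `g ≫ h = 0` exactly when `h` factors
through `coker g`. So presentability passes to the syzygy, as dimension shifting needs. -/
theorem isPresented_ker {b : F.obj.obj B} {g : B ⟶ B'} (hg : IsRelator b g) (w : repr B ⟶ F)
    (hw : component w B (𝟙 B) = b) : (ker w).IsPresented := by
  have mem : ∀ {S} (f : B ⟶ S), component w S f = 0 ↔ ∃ h : B' ⟶ S, f = g ≫ h := fun f => by
    rw [component_repr, hw]
    exact hg _ f
  refine ⟨B', cokernel g, cokernel.π g, ⟨g, (mem g).2 ⟨𝟙 B', (Category.comp_id g).symm⟩⟩,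
    fun S x => ?_, fun S f => ⟨fun h => ?_, ?_⟩⟩
  · obtain ⟨h, hh⟩ := (mem x.1).1 x.2
    exact ⟨h, Subtype.ext hh.symm⟩
  · exact ⟨cokernel.desc g f (congrArg Subtype.val h), (cokernel.π_desc _ _ _).symm⟩
  · rintro ⟨h, rfl⟩
    refine Subtype.ext ?_
    change g ≫ cokernel.π g ≫ h = 0
    simp

theorem subsingleton_ext (hT : T.IsRightExact) (i : ℕ) : ∀ F : RFun.{u} R, F.IsPresented →
    Subsingleton (Abelian.Ext.{u + 1} F T (i + 1)) := by
  induction i with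
  | zero =>
    rintro F ⟨B, B', g, b, hb, hg⟩
    obtain ⟨w, hw⟩ := exists_hom_repr b
    have hs := kerι_shortExact w fun S x => by
      obtain ⟨f, rfl⟩ := hb S x
      exact ⟨f, by rw [component_repr, hw]⟩
    refine subsingleton_of_forall_eq 0 fun y => ?_
    obtain ⟨x, rfl⟩ := Abelian.Ext.contravariant_sequence_exact₃ hs T y
      (Abelian.Ext.eq_zero_of_projective _) (n₀ := 0) rfl
    obtain ⟨η, rfl⟩ := (Abelian.Ext.mk₀_bijective _ _).2 x
    -- A class in `Ext¹` is the boundary of some `η : ker w → T`; it is zero because `η` extends to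
    -- `Hom(B, -)`. The cokernel here is `F`, with relator `g`.
    obtain ⟨ε, rfl⟩ := exists_extension hT (kerι w) η
      (fun S d hd => by rw [show d = 0 from Subtype.ext hd, map_zero]) (isGenerator_id B) g
      fun S f => by
        rw [← hg S f, ← hw, ← component_repr]
        refine ⟨?_, fun h => ⟨⟨f, h⟩, (Category.id_comp f).symm⟩⟩
        rintro ⟨d, hd⟩
        rw [show f = d.1 from (Category.id_comp f).symm.trans hd.symm]
        exact d.2
    rw [← Abelian.Ext.mk₀_comp_mk₀]
    exact hs.extClass_comp_assoc _
  | succ i ih =>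
    rintro F ⟨B, B', g, b, hb, hg⟩
    obtain ⟨w, hw⟩ := exists_hom_repr b
    have hs := kerι_shortExact w fun S x => by
      obtain ⟨f, rfl⟩ := hb S x
      exact ⟨f, by rw [component_repr, hw]⟩
    refine subsingleton_of_forall_eq 0 fun y => ?_
    obtain ⟨x, rfl⟩ := Abelian.Ext.contravariant_sequence_exact₃ hs T y
      (Abelian.Ext.eq_zero_of_projective _) (n₀ := i + 1) (by omega)
    have := ih _ (isPresented_ker hg w hw)
    rw [Subsingleton.elim x 0, Abelian.Ext.comp_zero]

end Ext

/-! ### Directed colimits of modules -/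

section DirectedColimits

variable {J : Type u} [Preorder J] [IsDirectedOrder J] [Nonempty J]

/-- Recognizing directed colimits of modules. -/
theorem nonempty_isColimit_of_elements {K : J ⥤ ModuleCat.{u} R} (c : Cocone K)
    (hc : ∀ x : c.pt, ∃ j y, c.ι.app j y = x)
    (hc' : ∀ j (y : K.obj j), c.ι.app j y = 0 → ∃ (k : J) (f : j ⟶ k), K.map f y = 0) :
    Nonempty (IsColimit c) := by
  have : ReflectsColimitsOfShape J (forget (ModuleCat.{u} R)) :=
    reflectsColimitsOfShape_of_reflectsIsomorphisms
  refine ⟨isColimitOfReflects (forget _) (Types.FilteredColimit.isColimitOf' _ _ (fun x => ?_)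
    fun j y y' h => ?_)⟩
  · obtain ⟨j, y, hy⟩ := hc x
    exact ⟨j, y, hy.symm⟩
  · obtain ⟨k, f, hf⟩ := hc' j (y - y') (by rw [map_sub]; exact sub_eq_zero.2 h)
    exact ⟨k, f, sub_eq_zero.1 ((map_sub (K.map f).hom y y').symm.trans hf)⟩

variable {F : RFun.{u} R}

theorem PreservesDirectLimits.exists_rep (hF : F.PreservesDirectLimits) {K : J ⥤ ModuleCat.{u} R}
    {c : Cocone K} (hc : IsColimit c) (x : F.obj.obj c.pt) :
    ∃ (j : J) (y : F.obj.obj (K.obj j)), F.act (c.ι.app j) y = x := by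
  have := hF J
  exact Concrete.isColimit_exists_rep (K ⋙ F.obj) (isColimitOfPreserves F.obj hc) x

theorem PreservesDirectLimits.exists_act_eq_zero (hF : F.PreservesDirectLimits)
    {K : J ⥤ ModuleCat.{u} R} {c : Cocone K} (hc : IsColimit c) {j : J} (y : F.obj.obj (K.obj j))
    (hy : F.act (c.ι.app j) y = 0) : ∃ (k : J) (f : j ⟶ k), F.act (K.map f) y = 0 := by
  have := hF J
  obtain ⟨k, f, g, h⟩ := Concrete.isColimit_exists_of_rep_eq (K ⋙ F.obj)
    (isColimitOfPreserves F.obj hc) y 0 (hy.trans (map_zero (F.act (c.ι.app j))).symm)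
  exact ⟨k, f, h.trans (map_zero (F.act (K.map g)))⟩

variable (S : ModuleCat.{u} R)

/-- The finitely generated submodules of `S`. -/
def fgDiagram : {N : Submodule R S // N.FG} ⥤ ModuleCat.{u} R where
  obj N := ModuleCat.of R N.1
  map f := ModuleCat.ofHom (Submodule.inclusion f.le)

/-- The cocone with point `S` on the finitely generated submodules of `S`. -/
def fgCocone : Cocone (fgDiagram S) where
  pt := S
  ι := { app N := ModuleCat.ofHom N.1.subtype }

theorem nonempty_isColimit_fgCocone : Nonempty (IsColimit (fgCocone S)) := by
  refine nonempty_isColimit_of_elements _ (fun x => ?_) fun N y hy => ⟨N, 𝟙 N, ?_⟩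
  · exact ⟨⟨_, Submodule.fg_span_singleton x⟩, ⟨x, Submodule.mem_span_singleton_self x⟩, rfl⟩
  · exact Subtype.ext hy

variable {S} (N : Submodule R S)

instance : IsDirectedOrder {P : Submodule R S // P.FG ∧ P ≤ N} where
  directed P Q := ⟨⟨P.1 ⊔ Q.1, P.2.1.sup Q.2.1, sup_le P.2.2 Q.2.2⟩,
    le_sup_left (a := P.1), le_sup_right (a := P.1)⟩

instance : Nonempty {P : Submodule R S // P.FG ∧ P ≤ N} := ⟨⟨⊥, Submodule.fg_bot, bot_le⟩⟩

/-- The quotients of `S` by finitely generated submodules of `N`. -/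
def fgQuotDiagram : {P : Submodule R S // P.FG ∧ P ≤ N} ⥤ ModuleCat.{u} R where
  obj P := ModuleCat.of R (S ⧸ P.1)
  map f := ModuleCat.ofHom (Submodule.factor f.le)
  map_id _ := ModuleCat.hom_ext (Submodule.linearMap_qext _ rfl)
  map_comp _ _ := ModuleCat.hom_ext (Submodule.linearMap_qext _ rfl)

/-- For `q : S → M`, the cocone with point `M` on the quotients of `S` by finitely generated
submodules of the kernel of `q`. -/
def fgQuotCocone {M : ModuleCat.{u} R} (q : S ⟶ M) :
    Cocone (fgQuotDiagram (LinearMap.ker q.hom)) where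
  pt := M
  ι :=
    { app P := ModuleCat.ofHom (P.1.liftQ q.hom P.2.2)
      naturality _ _ _ := ModuleCat.hom_ext (Submodule.linearMap_qext _ rfl) }

/-- Every element of the kernel of `q` already dies modulo the finitely generated submodule enlarged
by that element. -/
theorem nonempty_isColimit_fgQuotCocone {M : ModuleCat.{u} R} (q : S ⟶ M)
    (hq : Function.Surjective q) : Nonempty (IsColimit (fgQuotCocone q)) := by
  refine nonempty_isColimit_of_elements _ (fun x => ?_) fun P y hy => ?_
  · obtain ⟨x, rfl⟩ := hq x
    exact ⟨⟨⊥, Submodule.fg_bot, bot_le⟩, Submodule.mkQ _ x, rfl⟩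
  · obtain ⟨y, rfl⟩ := Submodule.mkQ_surjective _ y
    have hy : y ∈ LinearMap.ker q.hom := hy
    refine ⟨⟨P.1 ⊔ R ∙ y, P.2.1.sup (Submodule.fg_span_singleton y),
      sup_le P.2.2 ((Submodule.span_singleton_le_iff_mem y _).2 hy)⟩,
      homOfLE (le_sup_left (a := P.1)), ?_⟩
    exact (Submodule.Quotient.mk_eq_zero _).2
      (le_sup_right (a := P.1) (Submodule.mem_span_singleton_self y))

theorem finitePresentation_quotient {M : Type*} [AddCommGroup M] [Module R M]
    [Module.FinitePresentation R M] {P : Submodule R M} (hP : P.FG) :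
    Module.FinitePresentation R (M ⧸ P) :=
  Module.finitePresentation_of_surjective P.mkQ (Submodule.mkQ_surjective _)
    (by rwa [Submodule.ker_mkQ])

end DirectedColimits

/-! ### FP modules have a finite presentation -/

section FP

variable {F : RFun.{u} R}

theorem PreservesDirectLimits.exists_finite (hF : F.PreservesDirectLimits)
    {S : ModuleCat.{u} R} (x : F.obj.obj S) :
    ∃ (N : ModuleCat.{u} R) (h : N ⟶ S) (y : F.obj.obj N), Module.Finite R N ∧ F.act h y = x := by
  obtain ⟨hc⟩ := nonempty_isColimit_fgCocone S
  obtain ⟨N, y, hy⟩ := hF.exists_rep hc x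
  exact ⟨_, _, y, Module.Finite.iff_fg.2 N.2, hy⟩

theorem PreservesDirectLimits.exists_factorization_finite (hF : F.PreservesDirectLimits)
    {B S : ModuleCat.{u} R} [Module.Finite R B] (b : F.obj.obj B) (h : B ⟶ S)
    (hb : F.act h b = 0) :
    ∃ (N : ModuleCat.{u} R) (k : B ⟶ N) (l : N ⟶ S),
      Module.Finite R N ∧ h = k ≫ l ∧ F.act k b = 0 := by
  obtain ⟨hc⟩ := nonempty_isColimit_fgCocone S
  -- The image of `h` is finitely generated since `B` is; the element dies in some larger finitely
  -- generated submodule, through which `h` still factors.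
  let N₀ : {N : Submodule R S // N.FG} := ⟨LinearMap.range h.hom, Submodule.FG.of_finite⟩
  let h₀ : B ⟶ (fgDiagram S).obj N₀ := ModuleCat.ofHom h.hom.rangeRestrict
  obtain ⟨N, f, hf⟩ := hF.exists_act_eq_zero hc (F.act h₀ b) (by rw [← act_comp]; exact hb)
  exact ⟨_, h₀ ≫ (fgDiagram S).map f, (fgCocone S).ι.app N, Module.Finite.iff_fg.2 N.2, rfl,
    by rw [act_comp, hf]⟩

theorem PreservesDirectLimits.exists_finitePresentation_quotient (hF : F.PreservesDirectLimits)
    {M S : ModuleCat.{u} R} [Module.FinitePresentation R M] (q : M ⟶ S)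
    (hq : Function.Surjective q) (x : F.obj.obj S) :
    ∃ (A : ModuleCat.{u} R) (h : A ⟶ S) (y : F.obj.obj A),
      Module.FinitePresentation R A ∧ F.act h y = x := by
  obtain ⟨hc⟩ := nonempty_isColimit_fgQuotCocone q hq
  obtain ⟨P, z, hz⟩ := hF.exists_rep hc x
  exact ⟨_, _, z, finitePresentation_quotient P.2.1, hz⟩

theorem PreservesDirectLimits.exists_factorization_quotient (hF : F.PreservesDirectLimits)
    {M S : ModuleCat.{u} R} [Module.FinitePresentation R M] (q : M ⟶ S)
    (hq : Function.Surjective q) (y : F.obj.obj M) (hy : F.act q y = 0) :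
    ∃ (A : ModuleCat.{u} R) (k : M ⟶ A) (l : A ⟶ S),
      Module.FinitePresentation R A ∧ q = k ≫ l ∧ F.act k y = 0 := by
  obtain ⟨hc⟩ := nonempty_isColimit_fgQuotCocone q hq
  let P₀ : {P : Submodule R M // P.FG ∧ P ≤ LinearMap.ker q.hom} := ⟨⊥, Submodule.fg_bot, bot_le⟩
  let i : M ⟶ (fgQuotDiagram (LinearMap.ker q.hom)).obj P₀ := ModuleCat.ofHom (Submodule.mkQ _)
  obtain ⟨P, g, hg⟩ := hF.exists_act_eq_zero hc (F.act i y) (by rw [← act_comp]; exact hy)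
  exact ⟨_, i ≫ (fgQuotDiagram _).map g, (fgQuotCocone q).ι.app P,
    finitePresentation_quotient P.2.1, rfl, by rw [act_comp, hg]⟩

/-- Two limits are used: `S` is the union of its finitely generated submodules, and each of these is
a direct limit of finitely presented quotients of a finite free module. -/
theorem PreservesDirectLimits.exists_finitePresentation (hF : F.PreservesDirectLimits)
    {S : ModuleCat.{u} R} (x : F.obj.obj S) :
    ∃ (A : ModuleCat.{u} R) (h : A ⟶ S) (y : F.obj.obj A),
      Module.FinitePresentation R A ∧ F.act h y = x := by
  obtain ⟨N, h, y, hN, rfl⟩ := hF.exists_finite x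
  obtain ⟨n, p, hp⟩ := Module.Finite.exists_fin' R N
  obtain ⟨A, k, z, hA, rfl⟩ := hF.exists_finitePresentation_quotient
    (M := ModuleCat.of R (Fin n → R)) (ModuleCat.ofHom p) hp y
  exact ⟨A, k ≫ h, z, hA, act_comp _ _ _⟩

theorem PreservesDirectLimits.exists_factorization (hF : F.PreservesDirectLimits)
    {B S : ModuleCat.{u} R} [Module.FinitePresentation R B] (b : F.obj.obj B) (h : B ⟶ S)
    (hb : F.act h b = 0) :
    ∃ (A : ModuleCat.{u} R) (k : B ⟶ A) (l : A ⟶ S),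
      Module.FinitePresentation R A ∧ h = k ≫ l ∧ F.act k b = 0 := by
  obtain ⟨N, k, l, hN, rfl, hk⟩ := hF.exists_factorization_finite b h hb
  obtain ⟨n, p, hp⟩ := Module.Finite.exists_fin' R N
  -- The summand `B` is added to the free cover so that `k` lifts to the finitely presented source
  -- of a surjection onto `N`.
  let i : B ⟶ ModuleCat.of R (B × (Fin n → R)) := ModuleCat.ofHom (LinearMap.inl R B (Fin n → R))
  let q : ModuleCat.of R (B × (Fin n → R)) ⟶ N := ModuleCat.ofHom (k.hom.coprod p)
  have hiq : i ≫ q = k := ModuleCat.hom_ext (LinearMap.coprod_inl _ _)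
  obtain ⟨A, k', l', hA, hq, h0⟩ := hF.exists_factorization_quotient q (fun x => by
    obtain ⟨y, rfl⟩ := hp x
    exact ⟨(0, y), congr($(LinearMap.coprod_inr k.hom p) y)⟩) (F.act i b) (by
      rw [← act_comp, hiq, hk])
  refine ⟨A, i ≫ k', l' ≫ l, hA, ?_, by rw [act_comp, h0]⟩
  rw [← hiq, hq]
  simp

theorem PreservesDirectProducts.exists_proj_eq (hF : F.PreservesDirectProducts) {I : Type u}
    (A : I → ModuleCat.{u} R) (x : ∀ i, F.obj.obj (A i)) :
    ∃ y : F.obj.obj (ModuleCat.of R (∀ i, A i)),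
      ∀ i, F.act (ModuleCat.ofHom (LinearMap.proj i)) y = x i := by
  have := hF I
  let hl := isLimitOfPreserves (forget AddCommGrpCat)
    (isLimitOfPreserves F.obj (ModuleCat.productConeIsLimit A))
  refine ⟨(Types.isLimitEquivSections hl).symm ⟨fun i => x i.as, ?_⟩, fun i =>
    Types.isLimitEquivSections_symm_apply hl _ ⟨i⟩⟩
  rintro ⟨i⟩ ⟨j⟩ ⟨⟨h⟩⟩
  obtain rfl : i = j := h
  exact act_id (x i)

theorem PreservesDirectProducts.eq_zero (hF : F.PreservesDirectProducts) {I : Type u}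
    (A : I → ModuleCat.{u} R) (y : F.obj.obj (ModuleCat.of R (∀ i, A i)))
    (hy : ∀ i, F.act (ModuleCat.ofHom (LinearMap.proj i : _ →ₗ[R] A i)) y = 0) : y = 0 := by
  have := hF I
  refine Concrete.isLimit_ext _ (isLimitOfPreserves F.obj (ModuleCat.productConeIsLimit A)) y 0 ?_
  rintro ⟨i⟩
  exact (hy i).trans (map_zero (F.act _)).symm

/-- A small set of representatives of the finitely presented modules. -/
abbrev FPIndex (R : Type u) [Ring R] : Type u := Σ n : ℕ, {N : Submodule R (Fin n → R) // N.FG}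

/-- The finitely presented module with a given index. -/
abbrev fpModule (j : FPIndex R) : ModuleCat.{u} R := ModuleCat.of R ((Fin j.1 → R) ⧸ j.2.1)

theorem exists_iso_fpModule (A : ModuleCat.{u} R) [Module.FinitePresentation R A] :
    ∃ j : FPIndex R, Nonempty (A ≅ fpModule j) := by
  obtain ⟨n, N, e, hN⟩ := Module.FinitePresentation.exists_fin R A
  exact ⟨⟨n, N, hN⟩, ⟨e.toModuleIso⟩⟩

theorem IsFP.exists_presentation (hF : F.IsFP) :
    ∃ (B B' : ModuleCat.{u} R) (g : B ⟶ B') (b : F.obj.obj B), Module.FinitePresentation R B ∧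
      Module.FinitePresentation R B' ∧ IsGenerator b ∧ IsRelator b g := by
  -- The index set is all pairs of a representative finitely presented module and an element of its
  -- value, so every such element is a projection of `y`.
  obtain ⟨y, hy⟩ := hF.2.exists_proj_eq
    (fun i : Σ j : FPIndex R, F.obj.obj (fpModule j) => fpModule i.1) fun i => i.2
  obtain ⟨B, h, b, hB, rfl⟩ := hF.1.exists_finitePresentation y
  -- The map from `B` to the product over all relations of `b` with values in the representatives
  -- kills `b`, since all its components do. Factoring it through a finitely presented `B'` in which
  -- `b` already dies yields the relator `g`.
  have hb : F.act _ b = 0 := hF.2.eq_zero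
    (fun i : Σ j : FPIndex R, {k : B ⟶ fpModule j // F.act k b = 0} => fpModule i.1)
    (F.act (ModuleCat.ofHom (LinearMap.pi fun i => i.2.1.hom)) b) fun i => by
      rw [← act_comp]
      exact i.2.2
  obtain ⟨B', g, l, hB', hgl, hg⟩ := hF.1.exists_factorization _ _ hb
  refine ⟨B, B', g, b, hB, hB', fun S x => ?_, fun S f => ⟨fun hf => ?_, ?_⟩⟩
  · obtain ⟨A, k, a, hA, rfl⟩ := hF.1.exists_finitePresentation x
    obtain ⟨j, ⟨e⟩⟩ := exists_iso_fpModule A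
    have := hy ⟨j, F.act e.hom a⟩
    rw [← act_comp] at this
    refine ⟨(h ≫ ModuleCat.ofHom (LinearMap.proj
      (⟨j, F.act e.hom a⟩ : Σ j : FPIndex R, F.obj.obj (fpModule j)))) ≫ e.inv ≫ k, ?_⟩
    rw [act_comp]
    refine (congrArg _ this).trans ?_
    dsimp only
    rw [← act_comp, e.hom_inv_id_assoc]
  · obtain ⟨A, k, l', hA, rfl, hk⟩ := hF.1.exists_factorization b f hf
    obtain ⟨j, ⟨e⟩⟩ := exists_iso_fpModule A
    have hk' : F.act (k ≫ e.hom) b = 0 := by rw [act_comp, hk, map_zero]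
    have := congr($hgl ≫ ModuleCat.ofHom (LinearMap.proj
      (⟨j, _, hk'⟩ : Σ j : FPIndex R, {k : B ⟶ fpModule j // F.act k b = 0})))
    refine ⟨l ≫ ModuleCat.ofHom (LinearMap.proj
      (⟨j, _, hk'⟩ : Σ j : FPIndex R, {k : B ⟶ fpModule j // F.act k b = 0})) ≫ e.inv ≫ l', ?_⟩
    rw [← Category.assoc, ← Category.assoc, ← this]
    change k ≫ l' = (k ≫ e.hom) ≫ e.inv ≫ l'
    simp
  · rintro ⟨k, rfl⟩
    rw [act_comp, hg, map_zero]

end FP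

/-! ### Tensor products -/

section Tensor

variable {M N : ModuleCat.{u} Rᵐᵒᵖ} {A B C S : ModuleCat.{u} R}

theorem smul_tmk (r : R) (m : M) (s : S) : tmk (MulOpposite.op r • m) s = tmk m (r • s) := by
  rw [← sub_eq_zero]
  exact (QuotientAddGroup.eq_zero_iff _).2 (AddSubgroup.subset_closure ⟨m, r, s, rfl⟩)

/-- The additive map `m ↦ m ⊗ s`. -/
def tmkLeft (M : ModuleCat.{u} Rᵐᵒᵖ) (s : S) : M →+ Tens M S :=
  AddMonoidHom.mk' (fun m => tmk m s) fun m m' => add_tmk m m' s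

/-- The additive map `s ↦ m ⊗ s`. -/
def tmkRight (S : ModuleCat.{u} R) (m : M) : S →+ Tens M S :=
  AddMonoidHom.mk' (fun s => tmk m s) fun s s' => tmk_add m s s'

/-- The additive map on `M ⊗_R S` given by a balanced biadditive map. -/
def Tens.lift {P : Type*} [AddCommGroup P] (φ : M →+ S →+ P)
    (h : ∀ m (r : R) s, φ (MulOpposite.op r • m) s = φ m (r • s)) : Tens M S →+ P :=
  QuotientAddGroup.lift _ (TensorProduct.liftAddHom (R := ℤ) φ (by simp)) (by
    rw [balancedRel, AddSubgroup.closure_le]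
    rintro _ ⟨m, r, s, rfl⟩
    exact (map_sub _ _ _).trans (sub_eq_zero.2 (h m r s)))

theorem tmap_left_surjective (g : B ⟶ C) (hg : Function.Surjective g) :
    Function.Surjective (tmap (𝟙 M) g) := by
  intro t
  obtain ⟨t, rfl⟩ := QuotientAddGroup.mk_surjective t
  obtain ⟨t, rfl⟩ := LinearMap.lTensor_surjective M
    (g := g.hom.toAddMonoidHom.toIntLinearMap) hg t
  exact ⟨QuotientAddGroup.mk t, rfl⟩

theorem exact_tmap_left (f : A ⟶ B) (g : B ⟶ C) (hg : Function.Surjective g)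
    (h : Function.Exact f g) (t : Tens M B) (ht : tmap (𝟙 M) g t = 0) :
    ∃ t', tmap (𝟙 M) f t' = t := by
  obtain ⟨t, rfl⟩ := QuotientAddGroup.mk_surjective t
  let f' := LinearMap.lTensor M f.hom.toAddMonoidHom.toIntLinearMap
  let g' := LinearMap.lTensor M g.hom.toAddMonoidHom.toIntLinearMap
  -- Since `g` is surjective, the balancing relations of `M ⊗ C` lift to those of `M ⊗ B`.
  -- Correcting `t` by such a relation reduces exactness to that of the tensor product over `ℤ`.
  have hle : balancedRel M C ≤ (balancedRel M B).map g'.toAddMonoidHom := by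
    rw [balancedRel, AddSubgroup.closure_le]
    rintro _ ⟨m, r, s, rfl⟩
    obtain ⟨s, rfl⟩ := hg s
    refine ⟨_, AddSubgroup.subset_closure ⟨m, r, s, rfl⟩,
      (map_sub g'.toAddMonoidHom _ _).trans (congrArg₂ (· - ·) rfl ?_)⟩
    exact congrArg (m ⊗ₜ[ℤ] ·) (map_smul g.hom r s)
  obtain ⟨x, hx, hxt⟩ := hle ((QuotientAddGroup.eq_zero_iff (g' t)).1 ht)
  obtain ⟨y, hy⟩ := (lTensor_exact M (f := f.hom.toAddMonoidHom.toIntLinearMap)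
    (g := g.hom.toAddMonoidHom.toIntLinearMap) h hg (t - x)).1
      ((map_sub g' t x).trans (sub_eq_zero.2 hxt.symm))
  refine ⟨QuotientAddGroup.mk y, QuotientAddGroup.eq_iff_sub_mem.2 ?_⟩
  change f' y - t ∈ _
  rw [show f' y = t - x from hy, sub_sub_cancel_left]
  exact neg_mem hx

theorem exact_tmap_right {A B C : ModuleCat.{u} Rᵐᵒᵖ} (f : A ⟶ B) (g : B ⟶ C)
    (hg : Function.Surjective g) (h : Function.Exact f g) (t : Tens B S)
    (ht : tmap g (𝟙 S) t = 0) : ∃ t', tmap f (𝟙 S) t' = t := by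
  obtain ⟨t, rfl⟩ := QuotientAddGroup.mk_surjective t
  let f' := LinearMap.rTensor S f.hom.toAddMonoidHom.toIntLinearMap
  let g' := LinearMap.rTensor S g.hom.toAddMonoidHom.toIntLinearMap
  have hle : balancedRel C S ≤ (balancedRel B S).map g'.toAddMonoidHom := by
    rw [balancedRel, AddSubgroup.closure_le]
    rintro _ ⟨m, r, s, rfl⟩
    obtain ⟨m, rfl⟩ := hg m
    refine ⟨_, AddSubgroup.subset_closure ⟨m, r, s, rfl⟩,
      (map_sub g'.toAddMonoidHom _ _).trans (congrArg₂ (· - ·) ?_ rfl)⟩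
    exact congrArg (· ⊗ₜ[ℤ] s) (map_smul g.hom (MulOpposite.op r) m)
  obtain ⟨x, hx, hxt⟩ := hle ((QuotientAddGroup.eq_zero_iff (g' t)).1 ht)
  obtain ⟨y, hy⟩ := (rTensor_exact S (f := f.hom.toAddMonoidHom.toIntLinearMap)
    (g := g.hom.toAddMonoidHom.toIntLinearMap) h hg (t - x)).1
      ((map_sub g' t x).trans (sub_eq_zero.2 hxt.symm))
  refine ⟨QuotientAddGroup.mk y, QuotientAddGroup.eq_iff_sub_mem.2 ?_⟩
  change f' y - t ∈ _
  rw [show f' y = t - x from hy, sub_sub_cancel_left]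
  exact neg_mem hx

variable (M) in
theorem isRightExact_quasiCoherent : ((quasiCoherent R).obj M).IsRightExact :=
  fun _ _ _ f g hg h t ht => exact_tmap_left f g hg h t ht

variable (S) in
theorem isRightExact_quasiCoherentRight : ((quasiCoherentRight R).obj S).IsRightExact :=
  fun _ _ _ f g hg h t ht => exact_tmap_right f g hg h t ht

end Tensor

/-! ### Morphisms between quasi-coherent modules -/

section Hom

variable {B S : ModuleCat.{u} R}

/-- The morphism `Rᵐᵒᵖ → N` with value `n` at `1`. -/
abbrev fromUnit {N : ModuleCat.{u} Rᵐᵒᵖ} (n : N) : ModuleCat.of Rᵐᵒᵖ Rᵐᵒᵖ ⟶ N :=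
  ModuleCat.ofHom (LinearMap.toSpanSingleton Rᵐᵒᵖ N n)

theorem fromUnit_one {N : ModuleCat.{u} Rᵐᵒᵖ} (n : N) : fromUnit n (1 : Rᵐᵒᵖ) = n :=
  one_smul Rᵐᵒᵖ n

/-- The isomorphism `R ⊗_R S → S`. -/
def unitTens (S : ModuleCat.{u} R) : Tens (ModuleCat.of Rᵐᵒᵖ Rᵐᵒᵖ) S →+ S :=
  Tens.lift
    (AddMonoidHom.mk' (fun x : Rᵐᵒᵖ => DistribSMul.toAddMonoidHom S x.unop) fun x y =>
      AddMonoidHom.ext fun s => add_smul x.unop y.unop s)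
    fun x r s => mul_smul x.unop r s

theorem unitTens_one (s : S) :
    unitTens S (tmk (M := ModuleCat.of Rᵐᵒᵖ Rᵐᵒᵖ) (1 : Rᵐᵒᵖ) s) = s :=
  one_smul R s

theorem tmk_unitTens (t : Tens (ModuleCat.of Rᵐᵒᵖ Rᵐᵒᵖ) S) :
    tmk (M := ModuleCat.of Rᵐᵒᵖ Rᵐᵒᵖ) (1 : Rᵐᵒᵖ) (unitTens S t) = t := by
  have : (tmkRight S (M := ModuleCat.of Rᵐᵒᵖ Rᵐᵒᵖ) (1 : Rᵐᵒᵖ)).comp (unitTens S) =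
      AddMonoidHom.id _ := Tens.hom_ext fun (x : Rᵐᵒᵖ) s => by
    refine (smul_tmk (M := ModuleCat.of Rᵐᵒᵖ Rᵐᵒᵖ) x.unop (1 : Rᵐᵒᵖ) s).symm.trans ?_
    exact congrArg (tmk (M := ModuleCat.of Rᵐᵒᵖ Rᵐᵒᵖ) · s) (mul_one x)
  exact congr($this t)

/-- At the right module `R` the morphism is a map `φ : B → S`, because `R ⊗ B = B`. Naturality along
`R → N`, `1 ↦ n`, forces `n ⊗ b ↦ n ⊗ φ(b)` everywhere. -/
theorem exists_eq_quasiCoherentRight_map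
    (w : (quasiCoherentRight R).obj B ⟶ (quasiCoherentRight R).obj S) :
    ∃ p : B ⟶ S, (quasiCoherentRight R).map p = w := by
  let U : ModuleCat Rᵐᵒᵖ := ModuleCat.of Rᵐᵒᵖ Rᵐᵒᵖ
  let φ : B →+ S := ((unitTens S).comp (component w U)).comp (tmkRight B (M := U) (1 : Rᵐᵒᵖ))
  have hφ : ∀ (N : ModuleCat Rᵐᵒᵖ) (n : N) (b : B),
      component w N (tmk n b : Tens N B) = (tmk n (φ b) : Tens N S) := fun N n b => by
    have h₁ : (tmk n b : Tens N B) = ((quasiCoherentRight R).obj B).act (fromUnit n)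
        (tmk (M := U) (1 : Rᵐᵒᵖ) b : Tens U B) := congrArg (tmk · b) (fromUnit_one n).symm
    have h₂ : (tmk n (φ b) : Tens N S) = ((quasiCoherentRight R).obj S).act (fromUnit n)
        (tmk (M := U) (1 : Rᵐᵒᵖ) (φ b) : Tens U S) :=
      congrArg (tmk · (φ b)) (fromUnit_one n).symm
    rw [h₁, h₂]
    exact (component_act w (fromUnit n) _).trans (congrArg _ (tmk_unitTens _).symm)
  have hsmul : ∀ (r : R) (b : B), φ (r • b) = r • φ b := fun r b => by
    have h := hφ U (MulOpposite.op r • (1 : Rᵐᵒᵖ)) b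
    rw [smul_tmk, smul_tmk] at h
    exact (congrArg (unitTens S) h).trans (unitTens_one _)
  refine ⟨ModuleCat.ofHom { φ with map_smul' := hsmul }, hom_ext_component fun N x => ?_⟩
  refine congr($(Tens.hom_ext (f := component ((quasiCoherentRight R).map _) N)
    (g := component w N) fun n b => ?_) x)
  exact (hφ N n b).symm

theorem exists_eq_lift_map {F G : RFun.{u} R} (w : lift.obj F ⟶ lift.obj G) :
    ∃ w' : F ⟶ G, lift.map w' = w :=
  ⟨mkHom (fun A => AddMonoidHom.mk' (fun x => (component w A (ULift.up x)).down) fun x y =>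
      congrArg ULift.down (map_add (component w A) (ULift.up x) (ULift.up y)))
    fun f x => congrArg ULift.down (component_act w f (ULift.up x)), rfl⟩

end Hom

/-! ### Quasi-coherent modules of finitely presented modules -/

section Free

variable {N : ModuleCat.{u} Rᵐᵒᵖ} {n : ℕ}

/-- The `i`-th coordinate `N ⊗_R Rⁿ → N`. -/
def coord (N : ModuleCat.{u} Rᵐᵒᵖ) (i : Fin n) :
    Tens N (ModuleCat.of R (Fin n → R)) →+ N :=
  Tens.lift
    (AddMonoidHom.mk' (fun x => AddMonoidHom.mk' (fun v : Fin n → R => MulOpposite.op (v i) • x)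
        fun v v' => add_smul (MulOpposite.op (v i)) (MulOpposite.op (v' i)) x)
      fun x y => AddMonoidHom.ext fun v => smul_add (MulOpposite.op (v i)) x y)
    fun x r v => (mul_smul (MulOpposite.op (v i)) (MulOpposite.op r) x).symm

theorem coord_tmk (i : Fin n) (x : N) (v : Fin n → R) :
    coord N i (tmk (S := ModuleCat.of R (Fin n → R)) x v) = MulOpposite.op (v i) • x := rfl

theorem sum_tmk_coord (t : Tens N (ModuleCat.of R (Fin n → R))) :
    ∑ i, tmk (S := ModuleCat.of R (Fin n → R)) (coord N i t) (Pi.single i 1 : Fin n → R) = t := by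
  have : ∑ i, (tmkLeft N (S := ModuleCat.of R (Fin n → R)) (Pi.single i 1 : Fin n → R)).comp
      (coord N i) = AddMonoidHom.id _ := Tens.hom_ext fun x (v : Fin n → R) => by
    rw [AddMonoidHom.finsetSum_apply]
    change _ = tmkRight (ModuleCat.of R (Fin n → R)) x v
    conv_rhs => rw [pi_eq_sum_univ' v]
    refine .trans ?_ (map_sum (tmkRight (ModuleCat.of R (Fin n → R)) x) _ _).symm
    refine Finset.sum_congr rfl fun i _ => (smul_tmk (v i) x _).trans ?_
    refine congrArg (tmk (S := ModuleCat.of R (Fin n → R)) x) ?_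
    ext j
    simp [Pi.single_apply, eq_comm]
  refine .trans ?_ congr($this t)
  rw [AddMonoidHom.finsetSum_apply]
  rfl

/-- The morphism from a free module with given values at the basis vectors. -/
abbrev fromFree (y : Fin n → N) : ModuleCat.of Rᵐᵒᵖ (Fin n → Rᵐᵒᵖ) ⟶ N :=
  ModuleCat.ofHom (Fintype.linearCombination Rᵐᵒᵖ y)

theorem fromFree_single (y : Fin n → N) (i : Fin n) :
    fromFree y (Pi.single i 1 : Fin n → Rᵐᵒᵖ) = y i := by
  refine (Fintype.linearCombination_apply_single Rᵐᵒᵖ y i 1).trans (one_smul _ _)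

theorem fromFree_ext {f g : ModuleCat.of Rᵐᵒᵖ (Fin n → Rᵐᵒᵖ) ⟶ N}
    (h : ∀ i, f (Pi.single i 1 : Fin n → Rᵐᵒᵖ) = g (Pi.single i 1 : Fin n → Rᵐᵒᵖ)) : f = g :=
  ModuleCat.hom_ext (LinearMap.pi_ext' fun i => LinearMap.ext_ring (h i))

/-- A presentation `Rᵐ → Rⁿ → B → 0` gives `N ⊗ Rᵐ → N ⊗ Rⁿ → N ⊗ B → 0`, and `N ⊗ Rⁿ` is the group
of morphisms to `N` from the free right module of rank `n`. -/
theorem isPresented_quasiCoherentRight (B : ModuleCat.{u} R) [Module.FinitePresentation R B] :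
    ((quasiCoherentRight R).obj B).IsPresented := by
  obtain ⟨n, m, p, k, hp, hkp⟩ := Module.FinitePresentation.exists_fin' R B
  let e (i : Fin n) : Fin n → R := Pi.single i 1
  let e' (j : Fin m) : Fin m → R := Pi.single j 1
  let ε (i : Fin n) : Fin n → Rᵐᵒᵖ := Pi.single i 1
  let ε' (j : Fin m) : Fin m → Rᵐᵒᵖ := Pi.single j 1
  let U := ModuleCat.of Rᵐᵒᵖ (Fin n → Rᵐᵒᵖ)
  let U' := ModuleCat.of Rᵐᵒᵖ (Fin m → Rᵐᵒᵖ)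
  let p' : ModuleCat.of R (Fin n → R) ⟶ B := ModuleCat.ofHom p
  let k' : ModuleCat.of R (Fin m → R) ⟶ ModuleCat.of R (Fin n → R) := ModuleCat.ofHom k
  -- `f : U → N` sends `x₀` to the class of the tensor with coordinates `f(ε i)`; `q` is the
  -- transpose of `k`.
  let x₀ : Tens U B := ∑ i, tmk (M := U) (ε i) (p (e i))
  let q : U ⟶ U' := fromFree fun i => ∑ j, MulOpposite.op (k (e' j) i) • ε' j
  have hact : ∀ (N : ModuleCat.{u} Rᵐᵒᵖ) (f : U ⟶ N),
      tmap f (𝟙 B) x₀ = ∑ i, tmk (f (ε i)) (p (e i)) := fun N f =>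
    map_sum (tmap f (𝟙 B)) _ _
  have hq : ∀ (N : ModuleCat.{u} Rᵐᵒᵖ) (h : U' ⟶ N) (i : Fin n),
      (q ≫ h) (ε i) = ∑ j, MulOpposite.op (k (e' j) i) • h (ε' j) := fun N h i => by
    refine (congrArg h (fromFree_single _ i)).trans ?_
    refine (map_sum h.hom _ _).trans (Finset.sum_congr rfl fun j _ => ?_)
    exact map_smul h.hom _ _
  refine ⟨U, U', q, x₀, fun N t => ?_, fun N f => ⟨fun hf => ?_, ?_⟩⟩
  · obtain ⟨t, rfl⟩ := tmap_left_surjective p' hp t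
    refine ⟨fromFree fun i => coord N i t, (hact N _).trans ?_⟩
    conv_rhs => rw [← sum_tmk_coord t]
    refine .trans ?_ (map_sum (tmap (𝟙 N) p') _ _).symm
    exact Finset.sum_congr rfl fun i _ => congrArg (tmk · _) (fromFree_single _ i)
  · replace hf := (hact N f).symm.trans hf
    obtain ⟨t, ht⟩ := exact_tmap_left k' p' hp hkp
      (∑ i, tmk (S := ModuleCat.of R (Fin n → R)) (f (ε i)) (e i))
      ((map_sum (tmap (𝟙 N) p') _ _).trans hf)
    refine ⟨fromFree fun j => coord N j t, fromFree_ext fun i => ?_⟩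
    refine .trans ?_ (hq N _ i).symm
    -- Comparing `i`-th coordinates in `N ⊗ Rⁿ` turns `ht` into the factorization of `f` through the
    -- transpose of `k`.
    have h₁ := congrArg (coord N i) ht
    rw [← sum_tmk_coord t, map_sum, map_sum, map_sum] at h₁
    refine .trans ?_ (h₁.symm.trans ?_)
    · rw [Finset.sum_eq_single i]
      · rw [coord_tmk]
        simp [e, ε]
      · intro j _ hj
        rw [coord_tmk]
        simp [e, hj.symm]
      · simp
    · refine Finset.sum_congr rfl fun j _ => ?_
      exact congrArg (MulOpposite.op (k (e' j) i) • ·)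
        (fromFree_single (fun j => coord N j t) j).symm
  · rintro ⟨h, rfl⟩
    refine (hact N _).trans ?_
    have : ∀ i, tmk ((q ≫ h) (ε i)) (p (e i)) =
        ∑ j, tmk (h (ε' j)) (k (e' j) i • p (e i)) := fun i => by
      rw [hq]
      refine (map_sum (tmkLeft N (p (e i))) _ _).trans (Finset.sum_congr rfl fun j _ => ?_)
      exact smul_tmk _ _ _
    rw [Finset.sum_congr rfl fun i _ => this i, Finset.sum_comm]
    refine Finset.sum_eq_zero fun j _ => ?_
    refine (map_sum (tmkRight B (h (ε' j))) _ _).symm.trans ?_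
    have hp0 : ∑ i, k (e' j) i • p (e i) = p (k (e' j)) := by
      conv_rhs => rw [pi_eq_sum_univ' (k (e' j))]
      rw [map_sum]
      refine Finset.sum_congr rfl fun i _ => (map_smul p _ _).symm.trans (congrArg p ?_)
      ext l
      simp [e, Pi.single_apply, eq_comm]
    rw [hp0, hkp.apply_apply_eq_zero, map_zero]

end Free

/-! ### Reflexivity -/

section Reflexive

variable {F T : RFun.{v} R} {B B' : ModuleCat.{u} R}

/-- For `T = 𝓝` this identifies the dual of `F` with the kernel of `𝓑 → 𝓑'`, through `w ↦ w(b)`. -/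
theorem exists_hom_iff {b : F.obj.obj B} {g : B ⟶ B'} (hb : IsGenerator b) (hg : IsRelator b g)
    (t : T.obj.obj B) : (∃ w : F ⟶ T, component w B b = t) ↔ T.act g t = 0 := by
  constructor
  · rintro ⟨w, rfl⟩
    rw [← component_act, (hg _ g).2 ⟨𝟙 B', (Category.comp_id g).symm⟩, map_zero]
  · refine fun h => exists_hom_of_isGenerator hb t fun S f hf => ?_
    obtain ⟨k, rfl⟩ := (hg S f).1 hf
    rw [act_comp, h, map_zero]

theorem IsGenerator.hom_ext {b : F.obj.obj B} (hb : IsGenerator b) {w w' : F ⟶ T}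
    (h : component w B b = component w' B b) : w = w' :=
  hom_ext_component fun S x => by
    obtain ⟨f, rfl⟩ := hb S x
    rw [component_act, component_act, h]

theorem IsGenerator.lift {F : RFun.{u} R} {b : F.obj.obj B} (hb : IsGenerator b) :
    IsGenerator (F := lift.obj F) (ULift.up b) := fun S x => by
  obtain ⟨f, hf⟩ := hb S x.down
  exact ⟨f, congrArg ULift.up hf⟩

theorem IsRelator.lift {F : RFun.{u} R} {b : F.obj.obj B} {g : B ⟶ B'} (hg : IsRelator b g) :
    IsRelator (F := lift.obj F) (ULift.up b) g := fun S f =>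
  ⟨fun h => (hg S f).1 (congrArg ULift.down h), fun h => congrArg ULift.up ((hg S f).2 h)⟩

theorem IsRightExact.lift {T : RFun.{u} R} (hT : T.IsRightExact) : (lift.obj T).IsRightExact :=
  fun _ _ _ f g hg h t ht => by
    obtain ⟨t', ht'⟩ := hT f g hg h t.down (congrArg ULift.down ht)
    exact ⟨ULift.up t', congrArg ULift.up ht'⟩

theorem toBidual_surjective {G : RFun.{u + 1} R} [Module.FinitePresentation R B]
    [Module.FinitePresentation R B'] {b : G.obj.obj B} {g : B ⟶ B'} (hb : IsGenerator b)
    (hg : IsRelator b g) (S : ModuleCat.{u} R) :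
    Function.Surjective (component G.toBidual S) := by
  intro (η : G.dual ⟶ lift.obj ((quasiCoherentRight R).obj S))
  obtain ⟨X₀, -, -, x₀, hx₀, -⟩ := isPresented_quasiCoherentRight B
  obtain ⟨Y₀, Y₁, r, y₀, hy₀, hr⟩ := isPresented_quasiCoherentRight B'
  -- `f` carries `x₀` into the dual of `G` exactly when it kills the image of `x₀` in `𝓑'`; `q` is
  -- the relator of that image.
  obtain ⟨Q, q, hq⟩ := exists_isRelator hy₀ hr (component ((quasiCoherentRight R).map g) X₀ x₀)
  obtain ⟨ε, hε⟩ := exists_extension (isRightExact_quasiCoherentRight S).lift (evalAt G B b) η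
    (fun N (d : G ⟶ _) hd => by
      rw [show d = 0 from hb.hom_ext hd]
      exact map_zero (component η N)) hx₀.lift q fun N f => by
    rw [← hq N f, ← component_act]
    exact (exists_hom_iff hb hg _).trans
      ⟨fun h => congrArg ULift.down h, fun h => congrArg ULift.up h⟩
  obtain ⟨ε, rfl⟩ := exists_eq_lift_map ε
  obtain ⟨p, rfl⟩ := exists_eq_quasiCoherentRight_map ε
  refine ⟨G.act p b, ?_⟩
  rw [← hε]
  exact dual_hom_ext fun N w => component_act w p b

theorem toBidual_injective {G : RFun.{u + 1} R} [Module.FinitePresentation R B]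
    [Module.FinitePresentation R B'] {b : G.obj.obj B} {g : B ⟶ B'} (hb : IsGenerator b)
    (hg : IsRelator b g) (S : ModuleCat.{u} R) :
    Function.Injective (component G.toBidual S) := by
  refine (injective_iff_map_eq_zero _).2 fun x hx => ?_
  obtain ⟨p, rfl⟩ := hb S x
  have hx : evalAt G S (G.act p b) = 0 := hx
  let C : ModuleCat.{u} R := ModuleCat.of R (B' ⧸ LinearMap.range g.hom)
  let π : B' ⟶ C := ModuleCat.ofHom (Submodule.mkQ _)
  -- This makes `𝓒`, the cokernel of `𝓑 → 𝓑'`, a presented functor, as the extension along `𝓑 → 𝓑'`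
  -- requires.
  have : Module.FinitePresentation R C := finitePresentation_quotient Submodule.FG.of_finite
  have hgπ : Function.Exact g π := LinearMap.exact_iff.2 (Submodule.ker_mkQ _)
  have hπ : g ≫ π = 0 := ModuleCat.hom_ext (LinearMap.ext fun x => hgπ.apply_apply_eq_zero x)
  obtain ⟨X₀, -, -, x₀, hx₀, -⟩ := isPresented_quasiCoherentRight B'
  obtain ⟨Y₀, Y₁, r, y₀, hy₀, hr⟩ := isPresented_quasiCoherentRight C
  obtain ⟨Q, q, hq⟩ := exists_isRelator hy₀ hr (component ((quasiCoherentRight R).map π) X₀ x₀)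
  obtain ⟨ε, hε⟩ := exists_extension (isRightExact_quasiCoherentRight S)
    ((quasiCoherentRight R).map g) ((quasiCoherentRight R).map p)
    (fun N d hd => by
      -- An element `d` of the kernel of `𝓑 → 𝓑'` is `w(b)` for some `w : G → 𝓝`, and `p` sends it
      -- to `w(G(p)(b)) = 0`.
      obtain ⟨w, hw⟩ := (exists_hom_iff (T := lift.obj ((quasiCoherent R).obj N)) hb hg
        (ULift.up d)).2 (congrArg ULift.up hd)
      have h : component w S (G.act p b) = 0 := congr(component $hx N w)
      rw [component_act, hw] at h
      exact congrArg ULift.down h) hx₀ q fun N f => by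
    rw [← hq N f, ← component_act]
    constructor
    · rintro ⟨d, hd⟩
      rw [← hd]
      change component ((quasiCoherentRight R).map g ≫ (quasiCoherentRight R).map π) N d = 0
      rw [← Functor.map_comp, hπ, Functor.map_zero]
      rfl
    · exact fun h => exact_tmap_left g π (Submodule.mkQ_surjective _) hgπ _ h
  obtain ⟨p', rfl⟩ := exists_eq_quasiCoherentRight_map ε
  -- The equality of morphisms of functors is evaluated at the right module `R`, where `R ⊗ S = S`.
  have hp : g ≫ p' = p := by
    ext y
    have h := congrArg (unitTens S)
      congr(component $hε (ModuleCat.of Rᵐᵒᵖ Rᵐᵒᵖ)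
        (tmk (M := ModuleCat.of Rᵐᵒᵖ Rᵐᵒᵖ) (1 : Rᵐᵒᵖ) y))
    exact (unitTens_one _).symm.trans (h.trans (unitTens_one _))
  exact (hg S p).2 ⟨p', hp.symm⟩

theorem isReflexive_of_bijective {G : RFun.{u + 1} R}
    (h : ∀ S, Function.Bijective (component G.toBidual S)) : G.IsReflexive := by
  have := mono_of_injective G.toBidual fun S => (h S).1
  have := epi_of_surjective G.toBidual fun S => (h S).2
  exact isIso_of_mono_of_epi G.toBidual

end Reflexive

end RFun

theorem mainTheorem8 (R : Type u) [Ring R] (F : RFun.{u} R) (hF : F.IsFP) :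
    (RFun.lift.obj F).IsReflexive ∧
      ∀ (M : ModuleCat.{u} Rᵐᵒᵖ) (i : ℕ), 0 < i →
        Subsingleton (Abelian.Ext.{u + 1} F ((RFun.quasiCoherent R).obj M) i) := by
  obtain ⟨B, B', g, b, hB, hB', hb, hg⟩ := hF.exists_presentation
  refine ⟨RFun.isReflexive_of_bijective fun S => ⟨RFun.toBidual_injective hb.lift hg.lift S,
    RFun.toBidual_surjective hb.lift hg.lift S⟩, fun M i hi => ?_⟩
  obtain ⟨i, rfl⟩ := Nat.exists_eq_succ_of_ne_zero hi.ne'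
  exact RFun.subsingleton_ext (RFun.isRightExact_quasiCoherent M) i F ⟨B, B', g, b, hb, hg⟩
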